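/- Let $\mathbb K$ be a field and $\mathbb K[X]=\mathbb K[x_1,\dots,x_n]$; write $\deg_i f$ for the exponent of $x_i$ in a monomial $f$. A set $B$ of monomials is a basis with the strong exchange property if all $f\in B$ have the same degree and, whenever $f,g\in B$ satisfy $\deg_i f>\deg_i g$ and $\deg_j f<\deg_j g$, also $\frac{x_j}{x_i}f\in B$. For a finite set $B$ of monomials, let $\mathbb K[B]\subseteq\mathbb K[X]$ be the subalgebra generated by $B$, and let $\mathcal J_B$ be the kernel of $\varphi:\mathbb K[y_f\mid f\in B]\to\mathbb K[X]$, $y_f\mapsto f$. A symmetric exchange relation is a binomial $y_fy_g-y_py_q$ with $f,g,p,q\in B$ for which there are $i,j$ with $\deg_i f>\deg_i g$, $\deg_j f<\deg_j g$, $p=\frac{x_j}{x_i}f$ and $q=\frac{x_i}{x_j}g$. Let $s\ge 1$, let $B_1,\dots,B_s$ be bases with the strong exchange property in $\mathbb K[X]$ which do not contain the monomial $1$, and let $B=B_1\cdots B_s=\{b_1\cdots b_s\mid b_j\in B_j\}$. Then: 1. The ideal $\mathcal J_B$ is generated by the symmetric exchange relations; that is, the conclusion of White's conjecture holds for $B$.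 2. Grade each $\mathbb K[B_j]$ so that the elements of $B_j$ have degree one, and let $\mathbb K[B_1]\circ\cdots\circ\mathbb K[B_s]=\bigoplus_{k\ge0}\mathbb K[B_1]_k\otimes_{\mathbb K}\cdots\otimes_{\mathbb K}\mathbb K[B_s]_k$ be the Segre product. There is an ideal $L$ of it, generated by binomials of degree one, i.e. by elements of the form $f_1\otimes\cdots\otimes f_s-g_1\otimes\cdots\otimes g_s$ with $f_j,g_j\in B_j$, and an isomorphism of $\mathbb K$-algebras $$\big(\mathbb K[B_1]\circ\cdots\circ\mathbb K[B_s]\big)/L\;\cong\;\mathbb K[B]$$ which sends the class of $f_1\otimes\cdots\otimes f_s$ to $f_1\cdots f_s$ for all $f_j\in B_j$. -/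

import Mathlib

open scoped TensorProduct

noncomputable section

namespace ToricSEP

universe u v w

/-! A monomial `x^α` in the variables `(x_i)_{i : σ}` is represented by its exponent vector
`α : σ →₀ ℕ`, so `deg_i` is evaluation at `i`, the total degree is `Finsupp.degree`, and the
product of monomials is the sum of exponent vectors. -/

section Bases

variable {σ : Type u}

/-- A set `B` of monomials is a basis with the strong exchange property: all its members have
the same degree, and `f, g ∈ B`, `deg_i f > deg_i g`, `deg_j f < deg_j g` imply
`(x_j / x_i) f ∈ B`. The quotient is the monomial `h` with `x_i h = x_j f`. -/
def StrongExchange (B : Set (σ →₀ ℕ)) : Prop :=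
  (∃ d : ℕ, ∀ f ∈ B, f.degree = d) ∧
    ∀ f ∈ B, ∀ g ∈ B, ∀ i j : σ, g i < f i → f j < g j →
      ∃ h ∈ B, h + Finsupp.single i 1 = f + Finsupp.single j 1

/-- The product `B_1 ⋯ B_s` of sets of monomials, `{b_1 ⋯ b_s | b_j ∈ B_j}`. -/
def productBasis {s : ℕ} (B : Fin s → Set (σ →₀ ℕ)) : Set (σ →₀ ℕ) :=
  {m | ∃ f : Fin s → (σ →₀ ℕ), (∀ j, f j ∈ B j) ∧ m = ∑ j, f j}

end Bases

section Toric

variable {σ : Type u} (K : Type v) [Field K] (B : Set (σ →₀ ℕ))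

/-- The homomorphism `φ : K[Y] → K[X]`, where `Y` has one variable `y_f` for every `f ∈ B`, and
`φ(y_f) = f`. -/
def toricMap : MvPolynomial B K →ₐ[K] MvPolynomial σ K :=
  MvPolynomial.aeval fun f : B => MvPolynomial.monomial (f : σ →₀ ℕ) (1 : K)

/-- The toric ideal `J_B = ker φ`. -/
def toricIdeal : Ideal (MvPolynomial B K) :=
  RingHom.ker (toricMap K B)

/-- The symmetric exchange relations: the binomials `y_r y_s - y_t y_u` for which there are
`i, j` with `deg_i r > deg_i s`, `deg_j r < deg_j s`, `t = (x_j / x_i) r`, `u = (x_i / x_j) s`. -/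
def symmetricExchangeRelations : Set (MvPolynomial B K) :=
  {p | ∃ (r s t u : B) (i j : σ),
    (s : σ →₀ ℕ) i < (r : σ →₀ ℕ) i ∧ (r : σ →₀ ℕ) j < (s : σ →₀ ℕ) j ∧
    (t : σ →₀ ℕ) + Finsupp.single i 1 = (r : σ →₀ ℕ) + Finsupp.single j 1 ∧
    (u : σ →₀ ℕ) + Finsupp.single j 1 = (s : σ →₀ ℕ) + Finsupp.single i 1 ∧
    p = MvPolynomial.X r * MvPolynomial.X s - MvPolynomial.X t * MvPolynomial.X u}

/-- The toric ring `K[B]`: the `K`-subalgebra of `K[X]` generated by the monomials in `B`. -/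
def toricRing : Subalgebra K (MvPolynomial σ K) :=
  Algebra.adjoin K ((fun f : σ →₀ ℕ => MvPolynomial.monomial f (1 : K)) '' B)

variable {B}

/-- The monomial `f ∈ B` as an element of `K[B]`. -/
def toricGen (f : B) : toricRing K B :=
  ⟨MvPolynomial.monomial (f : σ →₀ ℕ) (1 : K), Algebra.subset_adjoin ⟨f, f.2, rfl⟩⟩

variable (B)

/-- The standard grading of `K[B]`, in which the elements of `B` have degree one: the part of
degree `k` is the `K`-span of the products of `k` elements of `B`. When the monomials in `B` are
of the same degree `d > 0` this is the part of `K[B]` of degree `k * d` in `K[X]`. -/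
def toricGrading (k : ℕ) : Submodule K (toricRing K B) :=
  Submodule.span K (Set.range (toricGen K (B := B))) ^ k

instance toricGrading_gradedMonoid : SetLike.GradedMonoid (toricGrading K B) :=
  Submodule.nat_power_gradedMonoid _

theorem toricGen_mem (f : B) : toricGen K f ∈ toricGrading K B 1 := by
  rw [toricGrading, pow_one]
  exact Submodule.subset_span ⟨f, rfl⟩

end Toric

section Segre

variable {K : Type v} [Field K] {s : ℕ} {A : Fin s → Type w} [∀ j, CommRing (A j)]
  [∀ j, Algebra K (A j)] (𝒜 : ∀ j, ℕ → Submodule K (A j))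

/-- The part of degree `k` of the Segre product: the subspace `(A_1)_k ⊗ ⋯ ⊗ (A_s)_k` of
`A_1 ⊗ ⋯ ⊗ A_s`. -/
def segrePiece (k : ℕ) : Submodule K (⨂[K] j, A j) :=
  Submodule.span K {x | ∃ a : ∀ j, A j, (∀ j, a j ∈ 𝒜 j k) ∧ x = PiTensorProduct.tprod K a}

variable [∀ j, SetLike.GradedMonoid (𝒜 j)]

theorem one_mem_segre :
    (1 : ⨂[K] j, A j) ∈ ⨆ k, segrePiece 𝒜 k :=
  Submodule.mem_iSup_of_mem 0 (Submodule.subset_span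
    ⟨1, fun _ => SetLike.GradedOne.one_mem, rfl⟩)

theorem segrePiece_mul_mem {k l : ℕ} {x y : ⨂[K] j, A j} (hx : x ∈ segrePiece 𝒜 k)
    (hy : y ∈ segrePiece 𝒜 l) : x * y ∈ segrePiece 𝒜 (k + l) := by
  have h := Submodule.mul_mem_mul hx hy
  rw [segrePiece, segrePiece, Submodule.span_mul_span] at h
  refine Submodule.span_mono ?_ h
  rintro _ ⟨_, ⟨a, ha, rfl⟩, _, ⟨b, hb, rfl⟩, rfl⟩
  exact ⟨a * b, fun j => SetLike.GradedMul.mul_mem (ha j) (hb j),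
    PiTensorProduct.tprod_mul_tprod a b⟩

theorem mul_mem_segre (x y : ⨂[K] j, A j) (hx : x ∈ ⨆ k, segrePiece 𝒜 k)
    (hy : y ∈ ⨆ k, segrePiece 𝒜 k) : x * y ∈ ⨆ k, segrePiece 𝒜 k := by
  have h := Submodule.mul_mem_mul hx hy
  rw [Submodule.iSup_mul] at h
  refine (iSup_le fun k => ?_ : _ ≤ ⨆ k, segrePiece 𝒜 k) h
  rw [Submodule.mul_iSup]
  refine iSup_le fun l => Submodule.mul_le.2 fun a ha b hb => ?_
  exact Submodule.mem_iSup_of_mem (k + l) (segrePiece_mul_mem 𝒜 ha hb)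

/-- The Segre product `A_1 ∘ ⋯ ∘ A_s = ⨁_k (A_1)_k ⊗ ⋯ ⊗ (A_s)_k` of graded algebras over a
field, as a subalgebra of `A_1 ⊗ ⋯ ⊗ A_s`. -/
def segreProduct : Subalgebra K (⨂[K] j, A j) :=
  (⨆ k, segrePiece 𝒜 k).toSubalgebra (one_mem_segre 𝒜) (mul_mem_segre 𝒜)

instance segreProduct_commRing : CommRing (segreProduct 𝒜) :=
  (segreProduct 𝒜).toCommRing

instance segreProduct_algebra : Algebra K (segreProduct 𝒜) :=
  (segreProduct 𝒜).algebra

end Segre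

section SegreToric

variable {σ : Type u} (K : Type v) [Field K] {s : ℕ} (B : Fin s → Set (σ →₀ ℕ))

/-- The Segre product `K[B_1] ∘ ⋯ ∘ K[B_s]` of the toric rings with their standard gradings. -/
abbrev toricSegre :=
  segreProduct (A := fun j => toricRing K (B j)) fun j => toricGrading K (B j)

variable {B}

/-- The monomial `f_1 ⊗ ⋯ ⊗ f_s` of degree one of the Segre product, where `f_j ∈ B_j`. -/
def segreGen (f : ∀ j, B j) : toricSegre K B :=
  ⟨PiTensorProduct.tprod K fun j => toricGen K (f j),
    Submodule.mem_iSup_of_mem (p := segrePiece fun j => toricGrading K (B j)) 1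
      (Submodule.subset_span ⟨_, fun j => toricGen_mem K (B j) (f j), rfl⟩)⟩

variable (B)

/-- The binomials of degree one of the Segre product: differences
`f_1 ⊗ ⋯ ⊗ f_s - g_1 ⊗ ⋯ ⊗ g_s` with `f_j, g_j ∈ B_j`. -/
def segreLinearBinomials : Set (toricSegre K B) :=
  {b | ∃ f g : ∀ j, B j, b = segreGen K f - segreGen K g}

variable {B}

/-- The product `f_1 ⋯ f_s` as an element of `B_1 ⋯ B_s`. -/
def productElement (f : ∀ j, B j) : productBasis B :=
  ⟨∑ j, (f j : σ →₀ ℕ), fun j => (f j : σ →₀ ℕ), fun j => (f j).2, rfl⟩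

end SegreToric

end ToricSEP

end

noncomputable section

namespace ToricSEP

section Moves

variable {σ : Type*}

theorem exists_lt_of_degree_eq {f g : σ →₀ ℕ} (h : f.degree = g.degree) (hne : f ≠ g) :
    ∃ p, g p < f p := by
  by_contra! hle
  have hle : f ≤ g := hle
  have hg : f + (g - f) = g := add_tsub_cancel_of_le hle
  have h0 : (g - f).degree = 0 := by
    have := congrArg Finsupp.degree hg
    rw [map_add] at this
    omega
  rw [Finsupp.degree_eq_zero_iff] at h0
  rw [h0, add_zero] at hg
  exact hne hg

/-- The coordinates of a monomial obtained from `f` by replacing a factor `x_i` by `x_j`. -/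
theorem apply_of_move {f f' : σ →₀ ℕ} {i j : σ}
    (h : f' + Finsupp.single i 1 = f + Finsupp.single j 1) (k : σ) :
    (i = j → f' k = f k) ∧
      (i ≠ j → f' i + 1 = f i ∧ f' j = f j + 1 ∧ (k ≠ i → k ≠ j → f' k = f k)) := by
  classical
  have hk := fun k => DFunLike.congr_fun h k
  simp only [Finsupp.add_apply, Finsupp.single_apply] at hk
  refine ⟨fun hij => ?_, fun hij => ⟨?_, ?_, fun h1 h2 => ?_⟩⟩
  · subst hij
    simpa using hk k
  · simpa [hij.symm] using hk i
  · simpa [hij] using hk j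
  · simpa [h1.symm, h2.symm] using hk k

theorem add_eq_of_moves {f f' g g' : σ →₀ ℕ} {i j : σ}
    (h : f' + Finsupp.single i 1 = f + Finsupp.single j 1)
    (h' : g' + Finsupp.single j 1 = g + Finsupp.single i 1) : f' + g' = f + g := by
  apply add_right_cancel (b := Finsupp.single i 1 + Finsupp.single j 1)
  rw [add_add_add_comm, h, h', add_add_add_comm, add_comm (Finsupp.single j 1)]

theorem degree_tsub_lt_of_move {f f' g : σ →₀ ℕ} {i j : σ}
    (h : f' + Finsupp.single i 1 = f + Finsupp.single j 1) (hi : g i < f i) (hj : f j < g j) :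
    (f' - g).degree < (f - g).degree := by
  classical
  have hij : i ≠ j := by
    rintro rfl
    omega
  have key : (f' - g) + Finsupp.single i 1 = f - g := by
    ext k
    obtain ⟨h1, h2, h3⟩ := (apply_of_move h k).2 hij
    simp only [Finsupp.add_apply, Finsupp.tsub_apply, Finsupp.single_apply]
    by_cases hk : k = i
    · subst hk
      simp
      omega
    · by_cases hk' : k = j
      · subst hk'
        simp [hij]
        omega
      · simp [h3 hk hk', Ne.symm hk]
  rw [← key, map_add, Finsupp.degree_single]
  omega

end Moves

section SingleBasis

variable {σ : Type*} {B : Set (σ →₀ ℕ)}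

theorem StrongExchange.degree_eq (hB : StrongExchange B) (f g : B) :
    (f : σ →₀ ℕ).degree = (g : σ →₀ ℕ).degree := by
  obtain ⟨d, hd⟩ := hB.1
  rw [hd f f.2, hd g g.2]

theorem StrongExchange.exists_lt (hB : StrongExchange B) {f g : B} {q : σ}
    (h : (f : σ →₀ ℕ) q < (g : σ →₀ ℕ) q) : ∃ p, (g : σ →₀ ℕ) p < (f : σ →₀ ℕ) p :=
  exists_lt_of_degree_eq (hB.degree_eq f g) fun he => by
    rw [he] at h
    exact h.false

theorem StrongExchange.exists_move (hB : StrongExchange B) (f g : B) {i j : σ}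
    (hi : (g : σ →₀ ℕ) i < (f : σ →₀ ℕ) i) (hj : (f : σ →₀ ℕ) j < (g : σ →₀ ℕ) j) :
    ∃ f' : B, (f' : σ →₀ ℕ) + Finsupp.single i 1 = (f : σ →₀ ℕ) + Finsupp.single j 1 := by
  obtain ⟨h, hh, e⟩ := hB.2 f f.2 g g.2 i j hi hj
  exact ⟨⟨h, hh⟩, e⟩

/-- A basis with the strong exchange property is cut out by bounds on the exponents: a factor
`x_i` of `f` can be replaced by `x_j` as soon as the exponent of `x_i` is not minimal and that of
`x_j` is not maximal. -/
theorem StrongExchange.exists_move_of_bounds (hB : StrongExchange B) (f g h : B) {i j : σ}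
    (hi : (g : σ →₀ ℕ) i < (f : σ →₀ ℕ) i) (hj : (f : σ →₀ ℕ) j < (h : σ →₀ ℕ) j) :
    ∃ f' : B, (f' : σ →₀ ℕ) + Finsupp.single i 1 = (f : σ →₀ ℕ) + Finsupp.single j 1 := by
  induction hN : (h : σ →₀ ℕ) i using Nat.strong_induction_on generalizing h with
  | _ N ih =>
    by_cases h1 : (h : σ →₀ ℕ) i < (f : σ →₀ ℕ) i
    · exact hB.exists_move f h h1 hj
    by_cases h2 : (f : σ →₀ ℕ) j < (g : σ →₀ ℕ) j
    · exact hB.exists_move f g hi h2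
    by_cases hij : i = j
    · exact ⟨f, by rw [hij]⟩
    obtain ⟨r, hr⟩ := hB.exists_lt (f := g) (g := h) (q := i) (by omega)
    have hri : r ≠ i := by
      rintro rfl
      omega
    have hrj : r ≠ j := by
      rintro rfl
      omega
    obtain ⟨h', e⟩ := hB.exists_move h g (i := i) (j := r) (by omega) hr
    obtain ⟨e1, -, e3⟩ := (apply_of_move e j).2 hri.symm
    have := e3 (Ne.symm hij) hrj.symm
    exact ih _ (by omega) h' (by omega) rfl

end SingleBasis

@[to_additive]
theorem prod_eq_of_eq_off_pair {ι X M : Type*} [Fintype ι] [CommMonoid M] {F F' : ι → X}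
    {φ : X → M} {a b : ι} (hab : a ≠ b) (hoff : ∀ c, c ≠ a → c ≠ b → F' c = F c)
    (h : φ (F' a) * φ (F' b) = φ (F a) * φ (F b)) : ∏ c, φ (F' c) = ∏ c, φ (F c) := by
  classical
  have key : ∀ F : ι → X, ∏ c, φ (F c) =
      φ (F a) * φ (F b) * ∏ c ∈ (Finset.univ.erase a).erase b, φ (F c) := by
    intro F
    rw [mul_assoc, Finset.mul_prod_erase _ (fun c => φ (F c)) (by simp [hab.symm]),
      Finset.mul_prod_erase _ (fun c => φ (F c)) (Finset.mem_univ a)]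
  rw [key, key F, h]
  congr 1
  refine Finset.prod_congr rfl fun c hc => ?_
  simp only [Finset.mem_erase] at hc
  rw [hoff c hc.2.1 hc.1]

section Families

variable {σ : Type*} {B : Set (σ →₀ ℕ)} {ι : Type*} [Fintype ι]

theorem StrongExchange.exists_family_move (hB : StrongExchange B) (F : ι → B) {T : Finset ι}
    {a₁ a₂ : ι} (ha₁ : a₁ ∈ T) (ha₂ : a₂ ∈ T) (g h : B) {i j : σ}
    (hi : (g : σ →₀ ℕ) i < (F a₁ : σ →₀ ℕ) i) (hj : (F a₂ : σ →₀ ℕ) j < (h : σ →₀ ℕ) j) :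
    ∃ F' : ι → B, (∀ a ∉ T, F' a = F a) ∧
      ∑ a, (F' a : σ →₀ ℕ) = ∑ a, (F a : σ →₀ ℕ) ∧
      ∃ a ∈ T, ∃ f' : B,
        (f' : σ →₀ ℕ) + Finsupp.single i 1 = (F' a : σ →₀ ℕ) + Finsupp.single j 1 := by
  classical
  by_cases hij : i = j
  · exact ⟨F, fun _ _ => rfl, rfl, a₁, ha₁, F a₁, by rw [hij]⟩
  by_cases h1 : (F a₁ : σ →₀ ℕ) j < (h : σ →₀ ℕ) j
  · exact ⟨F, fun _ _ => rfl, rfl, a₁, ha₁, hB.exists_move_of_bounds _ g h hi h1⟩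
  by_cases h2 : (g : σ →₀ ℕ) i < (F a₂ : σ →₀ ℕ) i
  · exact ⟨F, fun _ _ => rfl, rfl, a₂, ha₂, hB.exists_move_of_bounds _ g h h2 hj⟩
  have hne : a₁ ≠ a₂ := by
    rintro rfl
    omega
  obtain ⟨r, hr⟩ := hB.exists_lt (f := F a₂) (g := F a₁) (q := i) (by omega)
  have hrj : r ≠ j := by
    rintro rfl
    omega
  obtain ⟨f₁, e₁⟩ := hB.exists_move (F a₁) (F a₂) (i := j) (j := r) (by omega) hr
  obtain ⟨f₂, e₂⟩ := hB.exists_move (F a₂) (F a₁) (i := r) (j := j) hr (by omega)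
  let F' : ι → B := Function.update (Function.update F a₁ f₁) a₂ f₂
  have hF₁ : F' a₁ = f₁ := by simp [F', hne]
  have hF₂ : F' a₂ = f₂ := by simp [F']
  have hoff : ∀ c, c ≠ a₁ → c ≠ a₂ → F' c = F c := fun c h h' => by simp [F', h, h']
  refine ⟨F', fun c hc => hoff c (by rintro rfl; exact hc ha₁) (by rintro rfl; exact hc ha₂),
    sum_eq_of_eq_off_pair (φ := fun f : B => (f : σ →₀ ℕ)) hne hoff ?_, a₁, ha₁, ?_⟩
  · rw [hF₁, hF₂]
    exact add_eq_of_moves e₁ e₂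
  · rw [hF₁]
    obtain ⟨k1, k2, k3⟩ := (apply_of_move e₁ i).2 hrj.symm
    have hri : r ≠ i := by
      rintro rfl
      omega
    have := k3 hij hri.symm
    exact hB.exists_move_of_bounds _ g (F a₁) (by omega) (by omega)

/-- White's conjecture for a basis with the strong exchange property, in the form that a function
of finite families in `B` is determined by the product of the family as soon as it does not change
when two members are replaced by two others with the same product. -/
theorem StrongExchange.eq_of_sum_eq (hB : StrongExchange B) {Z : Type*} {Ψ : (ι → B) → Z}
    (hΨ : ∀ F F' : ι → B, ∀ a b, a ≠ b → (∀ c, c ≠ a → c ≠ b → F' c = F c) →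
      (F' a : σ →₀ ℕ) + F' b = F a + F b → Ψ F' = Ψ F)
    {F G : ι → B} (hFG : ∑ a, (F a : σ →₀ ℕ) = ∑ a, (G a : σ →₀ ℕ)) : Ψ F = Ψ G := by
  classical
  suffices H : ∀ T : Finset ι, ∀ F G : ι → B, (∀ a ∉ T, F a = G a) →
      ∑ a, (F a : σ →₀ ℕ) = ∑ a, (G a : σ →₀ ℕ) → Ψ F = Ψ G from
    H Finset.univ F G (by simp) hFG
  intro T
  induction T using Finset.induction_on with
  | empty =>
    intro F G h _
    rw [funext fun a => h a (by simp)]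
  | insert a₀ T ha₀ ih =>
    intro F G h hs
    induction hN : ((F a₀ : σ →₀ ℕ) - (G a₀ : σ →₀ ℕ)).degree using Nat.strong_induction_on
      generalizing F with
    | _ N ihN =>
      by_cases h0 : F a₀ = G a₀
      · refine ih F G (fun a ha => ?_) hs
        by_cases haa : a = a₀
        · rw [haa, h0]
        · exact h a (by simp [haa, ha])
      obtain ⟨i, hi⟩ := exists_lt_of_degree_eq (hB.degree_eq (F a₀) (G a₀))
        (fun e => h0 (Subtype.ext e))
      obtain ⟨j, hj⟩ := hB.exists_lt hi
      have hsT : ∀ k, (F a₀ : σ →₀ ℕ) k + ∑ a ∈ T, (F a : σ →₀ ℕ) k =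
          (G a₀ : σ →₀ ℕ) k + ∑ a ∈ T, (G a : σ →₀ ℕ) k := by
        intro k
        have e : ∀ H : ι → B, (∑ a, (H a : σ →₀ ℕ)) k = (H a₀ : σ →₀ ℕ) k +
            ∑ a ∈ T, (H a : σ →₀ ℕ) k + ∑ a ∈ (insert a₀ T)ᶜ, (H a : σ →₀ ℕ) k := by
          intro H
          rw [Finsupp.finsetSum_apply, ← Finset.sum_add_sum_compl (insert a₀ T),
            Finset.sum_insert ha₀]
        have e' : ∑ a ∈ (insert a₀ T)ᶜ, (F a : σ →₀ ℕ) k =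
            ∑ a ∈ (insert a₀ T)ᶜ, (G a : σ →₀ ℕ) k :=
          Finset.sum_congr rfl fun a ha => by rw [h a (by simpa using ha)]
        have := e F
        rw [hs, e G, e'] at this
        omega
      obtain ⟨a₁, ha₁, h₁⟩ := Finset.exists_lt_of_sum_lt (s := T)
        (f := fun a => (G a : σ →₀ ℕ) j) (g := fun a => (F a : σ →₀ ℕ) j) (by
          have := hsT j
          omega)
      obtain ⟨a₂, ha₂, h₂⟩ := Finset.exists_lt_of_sum_lt (s := T)
        (f := fun a => (F a : σ →₀ ℕ) i) (g := fun a => (G a : σ →₀ ℕ) i) (by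
          have := hsT i
          omega)
      obtain ⟨F', hF', hsum, a, ha, f', e'⟩ :=
        hB.exists_family_move F ha₁ ha₂ (G a₁) (G a₂) h₁ h₂
      rw [← ih F' F hF' hsum]
      obtain ⟨f₀, e₀⟩ := hB.exists_move _ _ hi hj
      have hne : a₀ ≠ a := by
        rintro rfl
        exact ha₀ ha
      have hF₀ : F' a₀ = F a₀ := hF' a₀ ha₀
      let F'' : ι → B := Function.update (Function.update F' a₀ f₀) a f'
      have k₀ : F'' a₀ = f₀ := by simp [F'', hne]
      have k₁ : F'' a = f' := by simp [F'']
      have hoff : ∀ c, c ≠ a₀ → c ≠ a → F'' c = F' c := fun c h h' => by simp [F'', h, h']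
      have hadd : (F'' a₀ : σ →₀ ℕ) + F'' a = F' a₀ + F' a := by
        rw [k₀, k₁, hF₀]
        exact add_eq_of_moves e₀ e'
      rw [← hΨ F' F'' a₀ a hne hoff hadd]
      refine ihN _ ?_ F'' (fun c hc => ?_) ?_ rfl
      · rw [k₀, ← hN]
        exact degree_tsub_lt_of_move e₀ hi hj
      · simp only [Finset.mem_insert, not_or] at hc
        rw [hoff c hc.1 (by rintro rfl; exact hc.2 ha), hF' c hc.2, h c (by simp [hc])]
      · rw [← hs, ← hsum]
        exact sum_eq_of_eq_off_pair (φ := fun f : B => (f : σ →₀ ℕ)) hne hoff hadd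

end Families

/-- A cyclic pattern of sign changes between two families of vectors of the same sum. -/
theorem exists_cycle {σ κ : Type*} [Fintype κ] {m m' : κ → σ →₀ ℕ}
    (hdeg : ∀ j, (m j).degree = (m' j).degree) (hsum : ∑ j, m j = ∑ j, m' j) (hne : m ≠ m') :
    ∃ J : Finset κ, J.Nonempty ∧ ∃ p q : κ → σ,
      (∀ j ∈ J, m' j (p j) < m j (p j) ∧ m j (q j) < m' j (q j)) ∧
      ∑ j ∈ J, Finsupp.single (q j) 1 = ∑ j ∈ J, (Finsupp.single (p j) 1 : σ →₀ ℕ) := by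
  classical
  let S := {j // m j ≠ m' j}
  have hp : ∀ j : S, ∃ p, m' j p < m j p := fun j => exists_lt_of_degree_eq (hdeg j) j.2
  choose p hp using hp
  have hτ : ∀ j : S, ∃ k : S, m k (p j) < m' k (p j) := by
    intro j
    by_contra! hle
    have hlt : ∑ k, m' k (p j) < ∑ k, m k (p j) := by
      refine Finset.sum_lt_sum (fun k _ => ?_) ⟨j, Finset.mem_univ _, hp j⟩
      by_cases hk : m k = m' k
      · rw [hk]
      · exact hle ⟨k, hk⟩
    have := DFunLike.congr_fun hsum (p j)
    rw [Finsupp.finsetSum_apply, Finsupp.finsetSum_apply] at this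
    omega
  choose τ hτ using hτ
  obtain ⟨j₀, hj₀⟩ := Function.ne_iff.1 hne
  let P : Finset S := (Function.periodicPts τ).toFinset
  have hbij : Set.BijOn τ P P := by
    simpa [P] using Function.bijOn_periodicPts τ
  have hP : P.Nonempty := by
    obtain ⟨a, b, hab, e⟩ := Finite.exists_ne_map_eq_of_infinite fun k : ℕ => τ^[k] ⟨j₀, hj₀⟩
    wlog h : a < b generalizing a b
    · exact this b a hab.symm e.symm (by omega)
    refine ⟨τ^[a] ⟨j₀, hj₀⟩, ?_⟩
    rw [Set.mem_toFinset]
    refine ⟨b - a, by omega, ?_⟩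
    change τ^[b - a] (τ^[a] _) = _
    rw [← Function.iterate_add_apply, Nat.sub_add_cancel h.le]
    exact e.symm
  have : Nonempty S := ⟨⟨j₀, hj₀⟩⟩
  let ρ : S → S := Function.invFunOn τ P
  have hρ : ∀ j ∈ P, τ (ρ j) = j := fun j hj => Function.invFunOn_eq (hbij.surjOn hj)
  have hρ' : ∀ j ∈ P, ρ (τ j) = j := fun j hj => hbij.injOn.leftInvOn_invFunOn hj
  let p' : κ → σ := fun j => if h : m j ≠ m' j then p ⟨j, h⟩ else p ⟨j₀, hj₀⟩
  let q' : κ → σ := fun j => if h : m j ≠ m' j then p (ρ ⟨j, h⟩) else p ⟨j₀, hj₀⟩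
  have hp' : ∀ j : S, p' j = p j := fun j => dif_pos j.2
  have hq' : ∀ j : S, q' j = p (ρ j) := fun j => dif_pos j.2
  refine ⟨P.map (Function.Embedding.subtype _), hP.map, p', q', ?_, ?_⟩
  · intro j hj
    obtain ⟨j, hjP, rfl⟩ := Finset.mem_map.1 hj
    refine ⟨?_, ?_⟩
    · change m' j (p' j) < m j (p' j)
      rw [hp']
      exact hp j
    · change m j (q' j) < m' j (q' j)
      rw [hq']
      have := hτ (ρ j)
      rwa [hρ j hjP] at this
  · rw [Finset.sum_map, Finset.sum_map]
    symm
    refine Finset.sum_nbij τ hbij.mapsTo hbij.injOn hbij.surjOn fun j hj => ?_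
    change Finsupp.single (p' j) 1 = Finsupp.single (q' (τ j)) 1
    rw [hp', hq', hρ' j hj]

section ProductCore

variable {σ κ ι M : Type*} [Fintype κ] [Fintype ι] [CommMonoid M] {B : κ → Set (σ →₀ ℕ)}
  {φ : (∀ j, B j) → M}

/-- The value of a pair of products `x_1 ⋯ x_s`, `y_1 ⋯ y_s` does not change when two factors
`x_j, y_j ∈ B_j` are replaced by two others with the same product. -/
def PairInvariant (φ : (∀ j, B j) → M) : Prop :=
  ∀ (x y x' y' : ∀ j, B j) (j : κ), (∀ k, k ≠ j → x' k = x k ∧ y' k = y k) →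
    (x' j : σ →₀ ℕ) + y' j = x j + y j → φ x' * φ y' = φ x * φ y

theorem PairInvariant.prod_eq_of_forall_sum_eq (hφ : PairInvariant φ)
    (hB : ∀ j, StrongExchange (B j)) {F G : ι → ∀ j, B j}
    (h : ∀ j, ∑ a, (F a j : σ →₀ ℕ) = ∑ a, (G a j : σ →₀ ℕ)) :
    ∏ a, φ (F a) = ∏ a, φ (G a) := by
  classical
  suffices H : ∀ T : Finset κ, ∏ a, φ (F a) = ∏ a, φ (T.piecewise (G a) (F a)) by
    simpa using H Finset.univ
  intro T
  induction T using Finset.induction_on with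
  | empty => simp
  | insert j T hj ih =>
    let Ψ : (ι → B j) → M := fun c => ∏ a, φ (Function.update (T.piecewise (G a) (F a)) j (c a))
    have key : Ψ (fun a => F a j) = Ψ (fun a => G a j) := by
      refine (hB j).eq_of_sum_eq (fun c c' a b hab hoff hadd => ?_) (h j)
      refine prod_eq_of_eq_off_pair (φ := φ) hab (fun d h1 h2 => by rw [hoff d h1 h2]) ?_
      refine hφ _ _ _ _ j (fun k hk => ⟨?_, ?_⟩) ?_
      · rw [Function.update_of_ne hk, Function.update_of_ne hk]
      · rw [Function.update_of_ne hk, Function.update_of_ne hk]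
      · simpa using hadd
    rw [ih]
    simp only [Finset.piecewise_insert]
    refine Eq.trans ?_ key
    refine Finset.prod_congr rfl fun a _ => ?_
    congr 1
    refine (Function.update_eq_self_iff.2 ?_).symm
    simp [hj]

theorem PairInvariant.prod_eq_of_sum_eq (hφ : PairInvariant φ)
    (hφ' : ∀ x y : ∀ j, B j, ∑ j, (x j : σ →₀ ℕ) = ∑ j, (y j : σ →₀ ℕ) → φ x = φ y)
    (hB : ∀ j, StrongExchange (B j)) {F G : ι → ∀ j, B j}
    (h : ∑ a, ∑ j, (F a j : σ →₀ ℕ) = ∑ a, ∑ j, (G a j : σ →₀ ℕ)) :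
    ∏ a, φ (F a) = ∏ a, φ (G a) := by
  classical
  cases isEmpty_or_nonempty ι with
  | inl _ => simp
  | inr hι =>
  obtain ⟨a₀⟩ := hι
  induction hN : ∑ j, (∑ a, (F a j : σ →₀ ℕ) - ∑ a, (G a j : σ →₀ ℕ)).degree
    using Nat.strong_induction_on generalizing F with
  | _ N ih =>
    by_cases heq : ∀ j, ∑ a, (F a j : σ →₀ ℕ) = ∑ a, (G a j : σ →₀ ℕ)
    · exact hφ.prod_eq_of_forall_sum_eq hB heq
    obtain ⟨J, hJ, p, q, hpq, hJsum⟩ := exists_cycle (m := fun j => ∑ a, (F a j : σ →₀ ℕ))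
      (m' := fun j => ∑ a, (G a j : σ →₀ ℕ)) (fun j => by
        rw [map_sum, map_sum]
        exact Finset.sum_congr rfl fun a _ => (hB j).degree_eq _ _)
      (by rw [Finset.sum_comm, h, Finset.sum_comm]) (fun e => heq fun j => congrFun e j)
    have hcol : ∀ j, ∃ c : ι → B j, ∑ a, (c a : σ →₀ ℕ) = ∑ a, (F a j : σ →₀ ℕ) ∧
        ∃ f : B j, (f : σ →₀ ℕ) + (if j ∈ J then Finsupp.single (p j) 1 else 0) =
          (c a₀ : σ →₀ ℕ) + (if j ∈ J then Finsupp.single (q j) 1 else 0) := by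
      intro j
      by_cases hj : j ∈ J
      · obtain ⟨h1, h2⟩ := hpq j hj
        simp only [Finsupp.finsetSum_apply] at h1 h2
        obtain ⟨a₁, -, h₁⟩ := Finset.exists_lt_of_sum_lt h1
        obtain ⟨a₂, -, h₂⟩ := Finset.exists_lt_of_sum_lt h2
        obtain ⟨c, -, hc, a, -, f, hf⟩ := (hB j).exists_family_move (fun a => F a j)
          (Finset.mem_univ a₁) (Finset.mem_univ a₂) _ _ h₁ h₂
        refine ⟨c ∘ Equiv.swap a₀ a, ?_, f, ?_⟩
        · rw [← hc]
          exact Equiv.sum_comp (Equiv.swap a₀ a) fun a => (c a : σ →₀ ℕ)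
        · simpa [hj] using hf
      · exact ⟨fun a => F a j, rfl, F a₀ j, by simp [hj]⟩
    choose c hc f hf using hcol
    let F₁ : ι → ∀ j, B j := fun a j => c j a
    have e₁ : ∏ a, φ (F a) = ∏ a, φ (F₁ a) :=
      hφ.prod_eq_of_forall_sum_eq hB fun j => (hc j).symm
    have hfsum : ∑ j, (f j : σ →₀ ℕ) = ∑ j, (F₁ a₀ j : σ →₀ ℕ) := by
      have := Finset.sum_congr (rfl : (Finset.univ : Finset κ) = Finset.univ) fun j _ => hf j
      rw [Finset.sum_add_distrib, Finset.sum_add_distrib, Finset.sum_ite_mem, Finset.sum_ite_mem,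
        Finset.univ_inter, hJsum] at this
      exact add_right_cancel this
    let F₂ : ι → ∀ j, B j := Function.update F₁ a₀ f
    have hφ₂ : ∀ a, φ (F₂ a) = φ (F₁ a) := by
      intro a
      by_cases ha : a = a₀
      · subst ha
        simpa [F₂] using hφ' _ _ hfsum
      · simp [F₂, ha]
    have e₂ : ∏ a, φ (F₁ a) = ∏ a, φ (F₂ a) := Finset.prod_congr rfl fun a _ => (hφ₂ a).symm
    rw [e₁, e₂]
    have hcol₂ : ∀ j, ∑ a, (F₂ a j : σ →₀ ℕ) + (if j ∈ J then Finsupp.single (p j) 1 else 0) =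
        ∑ a, (F a j : σ →₀ ℕ) + (if j ∈ J then Finsupp.single (q j) 1 else 0) := by
      intro j
      rw [← hc j, ← Finset.add_sum_erase _ _ (Finset.mem_univ a₀),
        ← Finset.add_sum_erase _ (fun a => (c j a : σ →₀ ℕ)) (Finset.mem_univ a₀)]
      have : ∑ a ∈ Finset.univ.erase a₀, (F₂ a j : σ →₀ ℕ) =
          ∑ a ∈ Finset.univ.erase a₀, (c j a : σ →₀ ℕ) :=
        Finset.sum_congr rfl fun a ha => by simp [F₂, F₁, Finset.ne_of_mem_erase ha]
      rw [this, add_right_comm, add_right_comm (c j a₀ : σ →₀ ℕ), ← hf j]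
      simp [F₂]
    have hdist : ∀ j ∈ J, (∑ a, (F₂ a j : σ →₀ ℕ) - ∑ a, (G a j : σ →₀ ℕ)).degree <
        (∑ a, (F a j : σ →₀ ℕ) - ∑ a, (G a j : σ →₀ ℕ)).degree := fun j hj =>
      degree_tsub_lt_of_move (by simpa [hj] using hcol₂ j) (hpq j hj).1 (hpq j hj).2
    refine ih _ ?_ ?_ rfl
    · rw [← hN]
      obtain ⟨j, hj⟩ := hJ
      refine Finset.sum_lt_sum (fun k _ => ?_) ⟨j, Finset.mem_univ j, hdist j hj⟩
      by_cases hk : k ∈ J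
      · exact (hdist k hk).le
      · have := hcol₂ k
        simp only [hk, if_false, add_zero] at this
        rw [this]
    · rw [← h]
      have hrow : ∀ a, ∑ j, (F₂ a j : σ →₀ ℕ) = ∑ j, (F₁ a j : σ →₀ ℕ) := by
        intro a
        by_cases ha : a = a₀
        · subst ha
          simpa [F₂] using hfsum
        · simp [F₂, ha]
      simp only [hrow]
      rw [Finset.sum_comm, Finset.sum_comm (f := fun a j => (F a j : σ →₀ ℕ))]
      exact Finset.sum_congr rfl fun j _ => hc j

end ProductCore

section Exchange

variable {σ κ : Type*} [Fintype κ] {B : κ → Set (σ →₀ ℕ)}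

theorem sum_update_of_move [DecidableEq κ] (z : ∀ j, B j) {j : κ} {f : B j} {i l : σ}
    (h : (f : σ →₀ ℕ) + Finsupp.single i 1 = (z j : σ →₀ ℕ) + Finsupp.single l 1) :
    ∑ k, (Function.update z j f k : σ →₀ ℕ) + Finsupp.single i 1 =
      ∑ k, (z k : σ →₀ ℕ) + Finsupp.single l 1 := by
  rw [← Finset.add_sum_erase _ _ (Finset.mem_univ j),
    ← Finset.add_sum_erase _ (fun k => (z k : σ →₀ ℕ)) (Finset.mem_univ j)]
  have : ∑ k ∈ Finset.univ.erase j, (Function.update z j f k : σ →₀ ℕ) =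
      ∑ k ∈ Finset.univ.erase j, (z k : σ →₀ ℕ) :=
    Finset.sum_congr rfl fun k hk => by
      rw [Function.update_of_ne (Finset.ne_of_mem_erase hk)]
  rw [this, add_right_comm, add_right_comm (z j : σ →₀ ℕ), ← h]
  simp

/-- The symmetric exchange property of the product of bases with the strong exchange property. The
pair `(x, y)` moves towards `(t, w)`, which has the same products of factors. -/
theorem exists_symmetric_exchange_sum (hB : ∀ j, StrongExchange (B j)) (x y t w : ∀ j, B j)
    (hxy : ∀ j, (x j : σ →₀ ℕ) + y j = t j + w j) {l : σ}
    (hl : (∑ j, (x j : σ →₀ ℕ)) l < (∑ j, (t j : σ →₀ ℕ)) l) :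
    ∃ p, (∑ j, (t j : σ →₀ ℕ)) p < (∑ j, (x j : σ →₀ ℕ)) p ∧ ∃ x' y' : ∀ j, B j,
      ∑ j, (x' j : σ →₀ ℕ) + Finsupp.single p 1 = ∑ j, (x j : σ →₀ ℕ) + Finsupp.single l 1 ∧
      ∑ j, (y' j : σ →₀ ℕ) + Finsupp.single l 1 = ∑ j, (y j : σ →₀ ℕ) + Finsupp.single p 1 := by
  classical
  induction hN : ∑ j, ((x j : σ →₀ ℕ) - (t j : σ →₀ ℕ)).degree using Nat.strong_induction_on
    generalizing x y l with
  | _ N ih =>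
    have hl' := hl
    rw [Finsupp.finsetSum_apply, Finsupp.finsetSum_apply] at hl'
    obtain ⟨j, -, hj⟩ := Finset.exists_lt_of_sum_lt hl'
    obtain ⟨i, hi⟩ := (hB j).exists_lt hj
    have hw : ∀ k, (x j : σ →₀ ℕ) k + (y j : σ →₀ ℕ) k = (t j : σ →₀ ℕ) k + (w j : σ →₀ ℕ) k :=
      fun k => DFunLike.congr_fun (hxy j) k
    obtain ⟨f, hf⟩ := (hB j).exists_move (x j) (t j) hi hj
    obtain ⟨g, hg⟩ := (hB j).exists_move (y j) (w j) (i := l) (j := i)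
      (by have := hw l; omega) (by have := hw i; omega)
    have hx := sum_update_of_move x hf
    have hy := sum_update_of_move y hg
    by_cases hD : (∑ j, (t j : σ →₀ ℕ)) i < (∑ j, (x j : σ →₀ ℕ)) i
    · exact ⟨i, hD, _, _, hx, hy⟩
    have hil : i ≠ l := by
      rintro rfl
      omega
    obtain ⟨k1, k2, -⟩ := (apply_of_move hx i).2 hil
    obtain ⟨p, hp, x', y', hx', hy'⟩ := ih _ (by
        rw [← hN]
        refine Finset.sum_lt_sum (fun k _ => ?_) ⟨j, Finset.mem_univ j, ?_⟩
        · by_cases hk : k = j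
          · subst hk
            simpa using (degree_tsub_lt_of_move hf hi hj).le
          · rw [Function.update_of_ne hk]
        · simpa using degree_tsub_lt_of_move hf hi hj)
      (Function.update x j f) (Function.update y j g) (fun k => by
        by_cases hk : k = j
        · subst hk
          rw [← hxy k]
          simpa using add_eq_of_moves hf hg
        · rw [Function.update_of_ne hk, Function.update_of_ne hk, hxy k])
      (l := i) (by omega) rfl
    have hpi : p ≠ i := by
      rintro rfl
      omega
    have hpl : p ≠ l := by
      rintro rfl
      omega
    have k3 := ((apply_of_move hx p).2 hil).2.2 hpi hpl
    refine ⟨p, by omega, x', y', hx'.trans hx, ?_⟩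
    apply add_right_cancel (b := Finsupp.single i 1)
    rw [add_right_comm, hy', add_right_comm, hy, add_right_comm]

end Exchange

section Quadrics

variable {σ : Type*} (K : Type*) [Field K] {B : Set (σ →₀ ℕ)}

theorem symmetricExchangeRelations_subset_toricIdeal :
    symmetricExchangeRelations K B ⊆ toricIdeal K B := by
  rintro _ ⟨r, s, t, u, i, j, -, -, h, h', rfl⟩
  change toricMap K B _ = 0
  have := add_eq_of_moves h h'
  simp [toricMap, MvPolynomial.monomial_mul, this]

/-- If `B` has the symmetric exchange property then every quadric `y_r y_s - y_t y_u` with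
`t = (x_j / x_i) r` and `u = (x_i / x_j) s` is generated by symmetric exchange relations. -/
theorem quadric_mem_span
    (hB : ∀ (f g : B) (l : σ), (f : σ →₀ ℕ) l < (g : σ →₀ ℕ) l →
      ∃ p, (g : σ →₀ ℕ) p < (f : σ →₀ ℕ) p ∧ ∃ f' g' : B,
        (f' : σ →₀ ℕ) + Finsupp.single p 1 = (f : σ →₀ ℕ) + Finsupp.single l 1 ∧
        (g' : σ →₀ ℕ) + Finsupp.single l 1 = (g : σ →₀ ℕ) + Finsupp.single p 1)
    (r s t u : B) (i j : σ)
    (ht : (t : σ →₀ ℕ) + Finsupp.single i 1 = (r : σ →₀ ℕ) + Finsupp.single j 1)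
    (hu : (u : σ →₀ ℕ) + Finsupp.single j 1 = (s : σ →₀ ℕ) + Finsupp.single i 1) :
    MvPolynomial.X r * MvPolynomial.X s - MvPolynomial.X t * MvPolynomial.X u ∈
      Ideal.span (symmetricExchangeRelations K B) := by
  by_cases hij : i = j
  · subst hij
    rw [Subtype.ext (add_right_cancel ht), Subtype.ext (add_right_cancel hu), sub_self]
    exact zero_mem _
  have base : ∀ (r s t u : B) (i j : σ), (s : σ →₀ ℕ) i < (r : σ →₀ ℕ) i →
      (r : σ →₀ ℕ) j < (s : σ →₀ ℕ) j →
      (t : σ →₀ ℕ) + Finsupp.single i 1 = (r : σ →₀ ℕ) + Finsupp.single j 1 →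
      (u : σ →₀ ℕ) + Finsupp.single j 1 = (s : σ →₀ ℕ) + Finsupp.single i 1 →
      (MvPolynomial.X r * MvPolynomial.X s - MvPolynomial.X t * MvPolynomial.X u :
        MvPolynomial B K) ∈ Ideal.span (symmetricExchangeRelations K B) :=
    fun r s t u i j h1 h2 h3 h4 => Ideal.subset_span ⟨r, s, t, u, i, j, h1, h2, h3, h4, rfl⟩
  have step : ∀ (r s t u : B) (i j : σ), i ≠ j → (r : σ →₀ ℕ) i ≤ (s : σ →₀ ℕ) i →
      (r : σ →₀ ℕ) j < (s : σ →₀ ℕ) j →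
      (t : σ →₀ ℕ) + Finsupp.single i 1 = (r : σ →₀ ℕ) + Finsupp.single j 1 →
      (u : σ →₀ ℕ) + Finsupp.single j 1 = (s : σ →₀ ℕ) + Finsupp.single i 1 →
      (MvPolynomial.X r * MvPolynomial.X s - MvPolynomial.X t * MvPolynomial.X u :
        MvPolynomial B K) ∈ Ideal.span (symmetricExchangeRelations K B) := by
    intro r s t u i j hij hi hj ht hu
    obtain ⟨p, hp, r', s', hr', hs'⟩ := hB r s j hj
    have hpi : p ≠ i := by
      rintro rfl
      omega
    have hpj : p ≠ j := by
      rintro rfl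
      omega
    obtain ⟨t1, t2, t3⟩ := (apply_of_move ht p).2 hij
    obtain ⟨u1, u2, u3⟩ := (apply_of_move hu p).2 (Ne.symm hij)
    have t3 := t3 hpi hpj
    have u3 := u3 hpj hpi
    have h1 := base r s r' s' p j hp hj hr' hs'
    have h2 := base t u r' s' p i (by omega) (by omega)
      (hr'.trans ht.symm) (by
        apply add_right_cancel (b := Finsupp.single j 1)
        rw [add_right_comm, hs', add_right_comm (u : σ →₀ ℕ), hu, add_right_comm])
    have := sub_mem h1 h2
    rwa [sub_sub_sub_cancel_right] at this
  have ti := ((apply_of_move ht i).2 hij)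
  have ui := ((apply_of_move hu i).2 (Ne.symm hij))
  by_cases h1 : (s : σ →₀ ℕ) i < (r : σ →₀ ℕ) i
  · by_cases h2 : (r : σ →₀ ℕ) j < (s : σ →₀ ℕ) j
    · exact base r s t u i j h1 h2 ht hu
    · have := step s r u t j i (Ne.symm hij) (by omega) h1 hu ht
      rwa [mul_comm, mul_comm (MvPolynomial.X u)] at this
  · by_cases h2 : (r : σ →₀ ℕ) j < (s : σ →₀ ℕ) j
    · exact step r s t u i j hij (by omega) h2 ht hu
    · have := base t u r s j i (by omega) (by omega) ht.symm hu.symm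
      rw [← neg_sub]
      exact neg_mem this

end Quadrics

section Injectivity

theorem exists_eq_map_univ {α : Type*} (U : Multiset α) {k : ℕ} (hk : U.card = k) :
    ∃ F : Fin k → α, U = Finset.univ.val.map F := by
  obtain ⟨l, rfl⟩ : ∃ l : List α, (l : Multiset α) = U := ⟨U.toList, U.coe_toList⟩
  obtain rfl : l.length = k := by simpa using hk
  exact ⟨l.get, by rw [Fin.univ_val_map, List.ofFn_get]⟩

variable {σ κ K A : Type*} [Fintype κ] [Nonempty κ] [Field K] [CommRing A] [Algebra K A]
  {B : κ → Set (σ →₀ ℕ)} {γ : (∀ j, B j) → A}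

theorem PairInvariant.multiset_prod_eq {M : Type*} [CommMonoid M] {φ : (∀ j, B j) → M}
    (hφ : PairInvariant φ)
    (hφ' : ∀ x y : ∀ j, B j, ∑ j, (x j : σ →₀ ℕ) = ∑ j, (y j : σ →₀ ℕ) → φ x = φ y)
    (hB : ∀ j, StrongExchange (B j)) (hpos : ∀ j, ∀ f ∈ B j, f ≠ 0) {U V : Multiset (∀ j, B j)}
    (h : (U.map fun x => ∑ j, (x j : σ →₀ ℕ)).sum = (V.map fun x => ∑ j, (x j : σ →₀ ℕ)).sum) :
    (U.map φ).prod = (V.map φ).prod := by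
  have hcard : U.card = V.card := by
    by_contra hne
    obtain ⟨x⟩ : Nonempty (∀ j, B j) := by
      by_contra hemp
      rw [not_nonempty_iff] at hemp
      rw [Multiset.eq_zero_of_forall_notMem (s := U) fun a _ => hemp.elim a,
        Multiset.eq_zero_of_forall_notMem (s := V) fun a _ => hemp.elim a] at hne
      exact hne rfl
    have hd : ∀ y : ∀ j, B j,
        (∑ j, (y j : σ →₀ ℕ)).degree = ∑ j, (x j : σ →₀ ℕ).degree := fun y => by
      rw [map_sum]
      exact Finset.sum_congr rfl fun j _ => (hB j).degree_eq _ _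
    have hU : ∀ U : Multiset (∀ j, B j), ((U.map fun x => ∑ j, (x j : σ →₀ ℕ)).sum).degree =
        U.card * ∑ j, (x j : σ →₀ ℕ).degree := by
      intro U
      rw [map_multiset_sum, Multiset.map_map]
      simp only [Function.comp_def, hd]
      simp
    have h1 : 0 < ∑ j, (x j : σ →₀ ℕ).degree := by
      refine Finset.sum_pos (fun j _ => ?_) Finset.univ_nonempty
      rw [Nat.pos_iff_ne_zero, Ne, Finsupp.degree_eq_zero_iff]
      exact hpos j _ (x j).2
    have := congrArg Finsupp.degree h
    rw [hU, hU] at this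
    exact hne (Nat.eq_of_mul_eq_mul_right h1 this)
  obtain ⟨F, hF⟩ := exists_eq_map_univ U hcard
  obtain ⟨G, hG⟩ := exists_eq_map_univ V rfl
  generalize V.card = k at F G hF hG
  subst hF hG
  have := hφ.prod_eq_of_sum_eq hφ' hB (F := F) (G := G) (by
    rw [Multiset.map_map, Multiset.map_map] at h
    exact h)
  rw [Multiset.map_map, Multiset.map_map]
  exact this

/-- A `K`-algebra `A` generated by elements `γ x` for `x ∈ B_1 × ⋯ × B_s`, subject to the relations
of `PairInvariant` and to `γ x = γ y` whenever `x` and `y` have the same product, embeds into the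
polynomial ring. -/
theorem injective_of_pairInvariant (hγ : PairInvariant γ)
    (hγ' : ∀ x y : ∀ j, B j, ∑ j, (x j : σ →₀ ℕ) = ∑ j, (y j : σ →₀ ℕ) → γ x = γ y)
    (hB : ∀ j, StrongExchange (B j)) (hpos : ∀ j, ∀ f ∈ B j, f ≠ 0)
    (htop : Algebra.adjoin K (Set.range γ) = ⊤) (θ : A →ₐ[K] MvPolynomial σ K)
    (hθ : ∀ x, θ (γ x) = MvPolynomial.monomial (∑ j, (x j : σ →₀ ℕ)) 1) :
    Function.Injective θ := by
  classical
  let s : (σ →₀ ℕ) → A := fun m =>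
    if h : ∃ U : Multiset (∀ j, B j), (U.map fun x => ∑ j, (x j : σ →₀ ℕ)).sum = m then
      (h.choose.map γ).prod else 0
  let ψ : MvPolynomial σ K →ₗ[K] A := (MvPolynomial.basisMonomials σ K).constr K s
  have hθU : ∀ U : Multiset (∀ j, B j), θ (U.map γ).prod =
      MvPolynomial.monomial (U.map fun x => ∑ j, (x j : σ →₀ ℕ)).sum 1 := by
    intro U
    induction U using Multiset.induction_on with
    | empty => simp
    | cons a U ih => simp [ih, hθ, MvPolynomial.monomial_mul]
  have hψ : ∀ m, ψ (MvPolynomial.monomial m 1) = s m := fun m => by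
    have := (MvPolynomial.basisMonomials σ K).constr_basis K s m
    rwa [MvPolynomial.coe_basisMonomials] at this
  have key : ∀ a, ψ (θ a) = a := by
    intro a
    have ha : a ∈ Submodule.span K (Submonoid.closure (Set.range γ) : Set A) := by
      rw [← Algebra.adjoin_eq_span, htop]
      trivial
    induction ha using Submodule.span_induction with
    | mem a ha =>
      obtain ⟨U, rfl⟩ : ∃ U : Multiset (∀ j, B j), (U.map γ).prod = a := by
        induction ha using Submonoid.closure_induction with
        | mem a ha =>
          obtain ⟨x, rfl⟩ := ha
          exact ⟨{x}, by simp⟩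
        | one => exact ⟨0, by simp⟩
        | mul a b _ _ ha hb =>
          obtain ⟨U, rfl⟩ := ha
          obtain ⟨V, rfl⟩ := hb
          exact ⟨U + V, by simp⟩
      have hex : ∃ V : Multiset (∀ j, B j), (V.map fun x => ∑ j, (x j : σ →₀ ℕ)).sum =
          (U.map fun x => ∑ j, (x j : σ →₀ ℕ)).sum := ⟨U, rfl⟩
      rw [hθU, hψ]
      simp only [s]
      rw [dif_pos hex]
      exact hγ.multiset_prod_eq hγ' hB hpos hex.choose_spec
    | zero => simp
    | add a b _ _ ha hb => rw [map_add, map_add, ha, hb]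
    | smul c a _ ha => rw [map_smul, map_smul, ha]
  exact Function.LeftInverse.injective key

end Injectivity

theorem productElement_surjective {σ : Type*} {s : ℕ} (B : Fin s → Set (σ →₀ ℕ)) :
    Function.Surjective (productElement : (∀ j, B j) → productBasis B) := by
  rintro ⟨_, f, hf, rfl⟩
  exact ⟨fun j => ⟨f j, hf j⟩, rfl⟩

section White

variable {σ : Type*} (K : Type*) [Field K] {s : ℕ} {B : Fin s → Set (σ →₀ ℕ)}

theorem quadric_mem_span_productBasis (hB : ∀ j, StrongExchange (B j))
    (r s t u : productBasis B) (i j : σ)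
    (ht : (t : σ →₀ ℕ) + Finsupp.single i 1 = (r : σ →₀ ℕ) + Finsupp.single j 1)
    (hu : (u : σ →₀ ℕ) + Finsupp.single j 1 = (s : σ →₀ ℕ) + Finsupp.single i 1) :
    MvPolynomial.X r * MvPolynomial.X s - MvPolynomial.X t * MvPolynomial.X u ∈
      Ideal.span (symmetricExchangeRelations K (productBasis B)) := by
  refine quadric_mem_span K (fun f g l hl => ?_) r s t u i j ht hu
  obtain ⟨x, rfl⟩ := productElement_surjective B f
  obtain ⟨y, rfl⟩ := productElement_surjective B g
  obtain ⟨p, hp, x', y', hx, hy⟩ :=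
    exists_symmetric_exchange_sum hB x y y x (fun j => add_comm _ _) hl
  exact ⟨p, hp, productElement x', productElement y', hx, hy⟩

theorem pairInvariant_mk_X (hB : ∀ j, StrongExchange (B j)) :
    PairInvariant fun x : ∀ j, B j =>
      Ideal.Quotient.mk (Ideal.span (symmetricExchangeRelations K (productBasis B)))
        (MvPolynomial.X (productElement x)) := by
  classical
  intro x y x' y' j hoff hadd
  induction hN : ((x j : σ →₀ ℕ) - (x' j : σ →₀ ℕ)).degree using Nat.strong_induction_on
    generalizing x y with
  | _ N ih =>
    by_cases hxj : x' j = x j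
    · rw [hxj] at hadd
      have hyj : y' j = y j := Subtype.ext (add_left_cancel hadd)
      obtain rfl : x' = x := funext fun k => by
        by_cases hk : k = j
        · rw [hk, hxj]
        · exact (hoff k hk).1
      obtain rfl : y' = y := funext fun k => by
        by_cases hk : k = j
        · rw [hk, hyj]
        · exact (hoff k hk).2
      rfl
    obtain ⟨i, hi⟩ := exists_lt_of_degree_eq ((hB j).degree_eq (x j) (x' j))
      (fun e => hxj (Subtype.ext e.symm))
    obtain ⟨l, hl⟩ := (hB j).exists_lt hi
    have hk : ∀ k, (x' j : σ →₀ ℕ) k + (y' j : σ →₀ ℕ) k =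
        (x j : σ →₀ ℕ) k + (y j : σ →₀ ℕ) k := fun k => DFunLike.congr_fun hadd k
    obtain ⟨f, hf⟩ := (hB j).exists_move (x j) (x' j) hi hl
    obtain ⟨g, hg⟩ := (hB j).exists_move (y j) (y' j) (i := l) (j := i)
      (by have := hk l; omega) (by have := hk i; omega)
    rw [ih _ ?_ (Function.update x j f) (Function.update y j g) (fun k hk => ?_) ?_ rfl]
    rotate_left
    · simpa [← hN] using degree_tsub_lt_of_move hf hi hl
    · rw [hadd]
      simpa using (add_eq_of_moves hf hg).symm
    · rw [Function.update_of_ne hk, Function.update_of_ne hk]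
      exact hoff k hk
    · symm
      rw [← map_mul, ← map_mul, Ideal.Quotient.mk_eq_mk_iff_sub_mem]
      exact quadric_mem_span_productBasis K hB _ _ _ _ i l (sum_update_of_move x hf)
        (sum_update_of_move y hg)

theorem toricIdeal_productBasis_eq [NeZero s] (hB : ∀ j, StrongExchange (B j))
    (hpos : ∀ j, ∀ f ∈ B j, f ≠ 0) :
    toricIdeal K (productBasis B) =
      Ideal.span (symmetricExchangeRelations K (productBasis B)) := by
  set I := Ideal.span (symmetricExchangeRelations K (productBasis B)) with hI
  have hle : I ≤ toricIdeal K (productBasis B) :=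
    Ideal.span_le.2 (symmetricExchangeRelations_subset_toricIdeal K)
  refine le_antisymm (fun p hp => ?_) hle
  let θ : (MvPolynomial (productBasis B) K ⧸ I) →ₐ[K] MvPolynomial σ K :=
    Ideal.Quotient.liftₐ I (toricMap K (productBasis B)) fun a ha => hle ha
  have hmk : ∀ a, θ (Ideal.Quotient.mk I a) = toricMap K (productBasis B) a := fun a => rfl
  have hinj : Function.Injective θ := by
    refine injective_of_pairInvariant (pairInvariant_mk_X K hB) (fun x y hxy => ?_) hB hpos ?_ θ
      fun x => ?_
    · rw [show productElement x = productElement y from Subtype.ext hxy]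
    · have hrange : Set.range (fun x : ∀ j, B j =>
          Ideal.Quotient.mk I (MvPolynomial.X (productElement x))) =
          Ideal.Quotient.mkₐ K I '' Set.range MvPolynomial.X := by
        rw [← Set.range_comp, ← (productElement_surjective B).range_comp]
        rfl
      rw [hrange, ← AlgHom.map_adjoin, MvPolynomial.adjoin_range_X, Algebra.map_top,
        AlgHom.range_eq_top]
      exact Ideal.Quotient.mkₐ_surjective K I
    · rw [hmk]
      simp [toricMap, productElement]
  rw [← Ideal.Quotient.eq_zero_iff_mem]
  apply hinj
  rw [hmk, map_zero]
  exact hp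

end White

section SegreQuotient

open scoped Pointwise

/-- A multilinear map sends a family of vectors in spans of sets `S j` to the span of its values
on the families with members in `S j`. -/
theorem _root_.MultilinearMap.map_mem_span {R κ N : Type*} [Finite κ] [CommSemiring R]
    {E : κ → Type*} [∀ j, AddCommMonoid (E j)] [∀ j, Module R (E j)] [AddCommMonoid N] [Module R N]
    (f : MultilinearMap R E N) {S : ∀ j, Set (E j)} {a : ∀ j, E j}
    (ha : ∀ j, a j ∈ Submodule.span R (S j)) :
    f a ∈ Submodule.span R (f '' {b | ∀ j, b j ∈ S j}) := by
  classical
  cases nonempty_fintype κ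
  suffices H : ∀ T : Finset κ, ∀ a : ∀ j, E j, (∀ j ∈ T, a j ∈ Submodule.span R (S j)) →
      (∀ j ∉ T, a j ∈ S j) → f a ∈ Submodule.span R (f '' {b | ∀ j, b j ∈ S j}) from
    H Finset.univ a (fun j _ => ha j) (by simp)
  intro T
  induction T using Finset.induction_on with
  | empty => exact fun a _ h => Submodule.subset_span ⟨a, fun j => h j (by simp), rfl⟩
  | insert j T hj ih =>
    intro a h h'
    have key : ∀ v ∈ Submodule.span R (S j), f (Function.update a j v) ∈
        Submodule.span R (f '' {b | ∀ j, b j ∈ S j}) := by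
      intro v hv
      induction hv using Submodule.span_induction with
      | mem v hv =>
        refine ih _ (fun k hk => ?_) (fun k hk => ?_)
        · have hkj : k ≠ j := by
            rintro rfl
            exact hj hk
          rw [Function.update_of_ne hkj]
          exact h k (by simp [hk])
        · by_cases hkj : k = j
          · subst hkj
            simpa using hv
          · rw [Function.update_of_ne hkj]
            exact h' k (by simp [hk, hkj])
      | zero =>
        rw [f.map_update_zero]
        exact zero_mem _
      | add v w _ _ hv hw =>
        rw [f.map_update_add]
        exact add_mem hv hw
      | smul c v _ hv =>
        rw [f.map_update_smul]
        exact Submodule.smul_mem _ c hv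
    have := key (a j) (h j (by simp))
    rwa [Function.update_eq_self] at this

variable {σ : Type*} (K : Type*) [Field K] {s : ℕ} {B : Fin s → Set (σ →₀ ℕ)}

theorem adjoin_range_segreGen :
    Algebra.adjoin K (Set.range (segreGen K : (∀ j, B j) → toricSegre K B)) = ⊤ := by
  set C := Algebra.adjoin K (Set.range (segreGen K : (∀ j, B j) → toricSegre K B)) with hC
  let v : toricSegre K B →ₐ[K] ⨂[K] j, toricRing K (B j) :=
    (segreProduct (A := fun j => toricRing K (B j)) fun j => toricGrading K (B j)).val
  have hle : (⨆ k, segrePiece (fun j => toricGrading K (B j)) k) ≤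
      Subalgebra.toSubmodule (C.map v) := by
    refine iSup_le fun k => ?_
    rw [segrePiece, Submodule.span_le]
    rintro _ ⟨a, ha, rfl⟩
    have ha' : ∀ j, a j ∈ Submodule.span K (Set.range (toricGen K (B := B j)) ^ k) := by
      intro j
      rw [← Submodule.span_pow]
      exact ha j
    refine Submodule.span_le.2 ?_ ((PiTensorProduct.tprod K).map_mem_span ha')
    rintro _ ⟨b, hb, rfl⟩
    have hb' : ∀ j, ∃ F : Fin k → B j, ∏ i, toricGen K (F i) = b j := by
      intro j
      obtain ⟨f, hf⟩ := Set.mem_pow.1 (hb j)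
      choose F hF using fun i => (f i).2
      refine ⟨F, ?_⟩
      rw [← hf, List.prod_ofFn]
      exact Finset.prod_congr rfl fun i _ => hF i
    choose F hF using hb'
    refine ⟨∏ i, segreGen K fun j => F j i,
      prod_mem fun i _ => Algebra.subset_adjoin ⟨_, rfl⟩, ?_⟩
    have : b = ∏ i, fun j => toricGen K (F j i) := by
      ext1 j
      rw [Finset.prod_apply, hF]
    change v _ = PiTensorProduct.tprodMonoidHom K b
    rw [this, map_prod, map_prod]
    rfl
  rw [eq_top_iff]
  rintro x -
  obtain ⟨y, hy, hyx⟩ := hle x.2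
  obtain rfl : y = x := Subtype.ext hyx
  exact hy

theorem segreGen_mul_segreGen {x y x' y' : ∀ j, B j}
    (h : ∀ j, (x' j : σ →₀ ℕ) + y' j = x j + y j) :
    segreGen K x' * segreGen K y' = segreGen K x * segreGen K y := by
  apply Subtype.ext
  change PiTensorProduct.tprod K _ * PiTensorProduct.tprod K _ =
    PiTensorProduct.tprod K _ * PiTensorProduct.tprod K _
  rw [PiTensorProduct.tprod_mul_tprod, PiTensorProduct.tprod_mul_tprod]
  congr 1
  ext1 j
  apply Subtype.ext
  change MvPolynomial.monomial (x' j : σ →₀ ℕ) (1 : K) * MvPolynomial.monomial _ 1 =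
    MvPolynomial.monomial _ 1 * MvPolynomial.monomial _ 1
  rw [MvPolynomial.monomial_mul, MvPolynomial.monomial_mul, h]

/-- The homomorphism `f_1 ⊗ ⋯ ⊗ f_s ↦ f_1 ⋯ f_s` from the Segre product to `K[X]`. -/
def segreMap (B : Fin s → Set (σ →₀ ℕ)) : toricSegre K B →ₐ[K] MvPolynomial σ K :=
  (PiTensorProduct.liftAlgHom
    ((MultilinearMap.mkPiAlgebra K (Fin s) (MvPolynomial σ K)).compLinearMap
      fun j => (toricRing K (B j)).val.toLinearMap)
    (by simp) (fun x y => by simp [Finset.prod_mul_distrib])).comp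
  (segreProduct (A := fun j => toricRing K (B j)) fun j => toricGrading K (B j)).val

theorem segreMap_segreGen (x : ∀ j, B j) :
    segreMap K B (segreGen K x) = MvPolynomial.monomial (∑ j, (x j : σ →₀ ℕ)) 1 := by
  rw [MvPolynomial.monomial_sum_one]
  change PiTensorProduct.lift _ (PiTensorProduct.tprod K _) = _
  rw [PiTensorProduct.lift.tprod]
  rfl

theorem pairInvariant_segreGen :
    PairInvariant (segreGen K : (∀ j, B j) → toricSegre K B) := by
  intro x y x' y' j hoff hadd
  refine segreGen_mul_segreGen K fun k => ?_
  by_cases hk : k = j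
  · rw [hk, hadd]
  · rw [(hoff k hk).1, (hoff k hk).2]

end SegreQuotient

section Quotient

variable {σ K A : Type*} [Field K] [CommRing A] [Algebra K A] {s : ℕ} {B : Fin s → Set (σ →₀ ℕ)}

/-- The relations between the elements `γ x` which identify those with the same product. -/
def productRelations (γ : (∀ j, B j) → A) : Set A :=
  {b | ∃ f g : ∀ j, B j, ∑ j, (f j : σ →₀ ℕ) = ∑ j, (g j : σ →₀ ℕ) ∧ b = γ f - γ g}

theorem exists_quotient_equiv_toricRing [NeZero s] (hB : ∀ j, StrongExchange (B j))
    (hpos : ∀ j, ∀ f ∈ B j, f ≠ 0) {γ : (∀ j, B j) → A} (hγ : PairInvariant γ)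
    (htop : Algebra.adjoin K (Set.range γ) = ⊤) (μ : A →ₐ[K] MvPolynomial σ K)
    (hμ : ∀ x, μ (γ x) = MvPolynomial.monomial (∑ j, (x j : σ →₀ ℕ)) 1) :
    ∃ e : (A ⧸ Ideal.span (productRelations γ)) ≃ₐ[K] toricRing K (productBasis B),
      ∀ f : ∀ j, B j, e (Ideal.Quotient.mk (Ideal.span (productRelations γ)) (γ f)) =
        toricGen K (productElement f) := by
  set L := Ideal.span (productRelations γ) with hL
  have hker : L ≤ RingHom.ker μ := by
    rw [hL, Ideal.span_le]
    rintro _ ⟨f, g, h, rfl⟩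
    change μ _ = 0
    rw [map_sub, hμ, hμ, h, sub_self]
  let θ : (A ⧸ L) →ₐ[K] MvPolynomial σ K := Ideal.Quotient.liftₐ L μ fun a ha => hker ha
  let γ' : (∀ j, B j) → A ⧸ L := fun x => Ideal.Quotient.mk L (γ x)
  have hθ : ∀ x, θ (γ' x) = MvPolynomial.monomial (∑ j, (x j : σ →₀ ℕ)) 1 := hμ
  have htop' : Algebra.adjoin K (Set.range γ') = ⊤ := by
    have hrange : Set.range γ' = Ideal.Quotient.mkₐ K L '' Set.range γ := by
      rw [← Set.range_comp]
      rfl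
    rw [hrange, ← AlgHom.map_adjoin, htop, Algebra.map_top, AlgHom.range_eq_top]
    exact Ideal.Quotient.mkₐ_surjective K _
  have hγ' : PairInvariant γ' := by
    intro x y x' y' j hoff hadd
    simp only [γ']
    rw [← map_mul, ← map_mul, hγ x y x' y' j hoff hadd]
  have hinj : Function.Injective θ :=
    injective_of_pairInvariant hγ'
      (fun x y h => (Ideal.Quotient.mk_eq_mk_iff_sub_mem _ _).2
        (Ideal.subset_span ⟨x, y, h, rfl⟩)) hB hpos htop' θ hθ
  have hrange : θ.range = toricRing K (productBasis B) := by
    rw [← Algebra.map_top, ← htop', AlgHom.map_adjoin, toricRing, ← Set.range_comp,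
      show θ ∘ γ' = _ from funext hθ]
    congr 1
    ext m
    constructor
    · rintro ⟨x, rfl⟩
      exact ⟨_, (productElement x).2, rfl⟩
    · rintro ⟨m, hm, rfl⟩
      obtain ⟨x, hx⟩ := productElement_surjective B ⟨m, hm⟩
      exact ⟨x, congrArg (fun f : productBasis B => MvPolynomial.monomial (f : σ →₀ ℕ) (1 : K)) hx⟩
  refine ⟨(AlgEquiv.ofInjective θ hinj).trans (Subalgebra.equivOfEq _ _ hrange), fun x => ?_⟩
  exact Subtype.ext (hθ x)

end Quotient

end ToricSEP

end

theorem theorem2p5 {K : Type*} [Field K] {n s : ℕ} (hs : 0 < s)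
    (B : Fin s → Set (Fin n →₀ ℕ))
    (hB : ∀ j, ToricSEP.StrongExchange (B j))
    (hpos : ∀ j, ∀ f ∈ B j, f ≠ 0) :
    ToricSEP.toricIdeal K (ToricSEP.productBasis B) =
        Ideal.span (ToricSEP.symmetricExchangeRelations K (ToricSEP.productBasis B)) ∧
    ∃ R : Set (ToricSEP.toricSegre K B), R ⊆ ToricSEP.segreLinearBinomials K B ∧
      ∃ e : (ToricSEP.toricSegre K B ⧸ Ideal.span R) ≃ₐ[K]
          ToricSEP.toricRing K (ToricSEP.productBasis B),
        ∀ f : ∀ j, B j, e (Ideal.Quotient.mk (Ideal.span R) (ToricSEP.segreGen K f)) =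
          ToricSEP.toricGen K (ToricSEP.productElement f) :=
  haveI : NeZero s := ⟨hs.ne'⟩
  ⟨ToricSEP.toricIdeal_productBasis_eq K hB hpos,
    ToricSEP.productRelations (ToricSEP.segreGen K), fun _ ⟨f, g, _, h⟩ => ⟨f, g, h⟩,
    ToricSEP.exists_quotient_equiv_toricRing hB hpos (ToricSEP.pairInvariant_segreGen K)
      (ToricSEP.adjoin_range_segreGen K) (ToricSEP.segreMap K B) (ToricSEP.segreMap_segreGen K)⟩
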